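/- Let $N\ge 1$, and let $p_1,p_2$ be chosen independently and uniformly at random from the $(N-1)!$ maximal cycles of the symmetric group on $\{1,\dots,N\}$ (the permutations consisting of a single cycle of length $N$). For $r\ge 2$ let $P_{N,r}$ be the probability that all cycles of the product $p_1p_2$ (fixed points counting as cycles of length $1$) have the same length $r$. Then $P_{N,r}=0$ if $r\nmid N$, and also if $r$ is even and $2r\nmid N$. If $r\mid N$, then $$P_{N,r}=\frac{N}{r^{N/r}(N/r)!}\int_0^1\bigl[t^r+(-1)^{r+1}(1-t)^r\bigr]^{N/r}\,dt =\frac{N}{(N+1)\,r^{N/r}(N/r)!}\sum_{\substack{0\le j\le N\\ r\mid j}}(-1)^{j(r+1)/r}\,\frac{\binom{N/r}{j/r}}{\binom{N}{j}}.$$ In particular, $$P_{N,2}=\frac{N}{2^{N/2}\,(N/2+1)!}\quad\text{if } 4\mid N,\qquad P_{N,3}=\frac{N}{(N/3)!\,12^{N/3}}\sum_{j=0}^{N/3}\binom{N/3}{j}\frac{3^j}{2j+1}\quad\text{if } 3\mid N.$$ -/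

import Mathlib

open scoped Nat

namespace CycleProduct

/-- The multiset of the lengths of all cycles of a permutation of an `N`-element set,
fixed points being counted as cycles of length `1`. -/
def cycleLengths {N : ℕ} (s : Equiv.Perm (Fin N)) : Multiset ℕ :=
  s.partition.parts

/-- The maximal cycles: the permutations that consist of a single cycle of length `N`. -/
def maxCycles (N : ℕ) : Finset (Equiv.Perm (Fin N)) :=
  Finset.univ.filter fun s => cycleLengths s = {N}

/-- All cycles of `s`, fixed points included, have length `r`. -/
def AllCyclesHaveLength {N : ℕ} (r : ℕ) (s : Equiv.Perm (Fin N)) : Prop :=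
  ∀ m ∈ cycleLengths s, m = r

instance {N : ℕ} (r : ℕ) :
    DecidablePred (AllCyclesHaveLength r : Equiv.Perm (Fin N) → Prop) := fun s =>
  inferInstanceAs (Decidable (∀ m ∈ cycleLengths s, m = r))

/-- The probability that the product of two independent, uniformly distributed maximal cycles
has the property `A`. The sample space is the set of ordered pairs of maximal cycles, all pairs
being equally likely. -/
def productProb (N : ℕ) (A : Equiv.Perm (Fin N) → Prop) [DecidablePred A] : ℚ :=
  (((maxCycles N ×ˢ maxCycles N).filter fun p => A (p.1 * p.2)).card : ℚ) /
    ((maxCycles N ×ˢ maxCycles N).card : ℚ)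

/-- The probability that all cycles of the product of two independent random maximal cycles
have length `r`. -/
def equalCyclesProb (N r : ℕ) : ℚ :=
  productProb N (AllCyclesHaveLength r)

end CycleProduct

/-! The core is a formula for any permutation `σ` of `n` points with matrix `P`: the number of
factorizations of `σ` into two full cycles is `(n-1)! * ∫₀¹ det((1-t) + t P) dt`
(`factorizationCount_eq`). If all cycles have length `r`, the determinant is `((1-t)^r -
(-t)^r)^(n/r)`; multiplying by the size of the conjugacy class and dividing by `(n-1)!^2` gives the
integral for the probability. The finite sum follows by binomial expansion and Beta integrals, the
vanishing for even `r` by parity.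

To detect that `σ τ⁻¹` is a full cycle, take the matrix with rows `e_(τ i) - e_(σ i)`, except that
row `x` is `e_(τ x)`. Its determinant is `sign τ` for a full cycle and `0` otherwise. Expanding by
rows gives a signed sum over sets `S` of determinants of mixed maps, `σ` on `S` and `τ` off `S`
(`sum_rowDet_avoiding`).

Summing over full cycles `τ` kills almost everything: conjugation by a transposition cancels terms
unless `S` and `σ(S)` differ by one exchange `a ↔ b`, and then `τ` is that transposition times a
full cycle on `S` and one on its complement (`sum_fullCycles_rowDet`). The factorials left over are
Beta integrals. The remaining transposition determinants are coefficients of the off-diagonal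
adjugate of `(1-t) + t P`; since that matrix has row sums `1`, its adjugate has entry sum `n * det`,
and what is left is an exact derivative (`sum_crossSum`, `integral_crossSum`). -/

namespace CycleProduct

/-! ### Full cycles: characterizations, sign and number. -/

section FullCycles

variable {α : Type*}

/-- A permutation is a full cycle if it acts transitively. -/
def IsFullCycle (τ : Equiv.Perm α) : Prop := ∀ x y, τ.SameCycle x y

/-- By finiteness, iterating forward from `f x` returns to `x`; hence forward-closed sets have
forward-closed complements. -/
theorem of_closed_of_apply [Finite α] (f : Equiv.Perm α) {P : α → Prop}
    (hP : ∀ x, P x → P (f x)) {x : α} (hx : P (f x)) : P x := by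
  obtain ⟨n, hn⟩ := (Equiv.Perm.sameCycle_apply_left.2
    (Equiv.Perm.SameCycle.refl f x)).exists_nat_pow_eq
  have : ∀ m : ℕ, P ((f ^ m) (f x)) := by
    intro m
    induction m with
    | zero => simpa using hx
    | succ m ih => rw [pow_succ', Equiv.Perm.mul_apply]; exact hP _ ih
  exact hn ▸ this n

theorem isFullCycle_iff_closed [Finite α] (τ : Equiv.Perm α) :
    IsFullCycle τ ↔ ∀ P : α → Prop, (∀ x, P x → P (τ x)) → (∃ x, P x) → ∀ x, P x := by
  constructor
  · rintro h P hP ⟨x, hx⟩ y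
    obtain ⟨n, rfl⟩ := (h x y).exists_nat_pow_eq
    clear h
    induction n with
    | zero => simpa using hx
    | succ n ih => rw [pow_succ', Equiv.Perm.mul_apply]; exact hP _ ih
  · intro h x
    exact h (fun y => τ.SameCycle x y) (fun y hy => Equiv.Perm.sameCycle_apply_right.2 hy)
      ⟨x, Equiv.Perm.SameCycle.refl _ _⟩

theorem IsFullCycle.conj {τ : Equiv.Perm α} (h : IsFullCycle τ) (g : Equiv.Perm α) :
    IsFullCycle (g * τ * g⁻¹) := fun x y => by
  rw [Equiv.Perm.sameCycle_conj]; exact h _ _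

variable [Fintype α] [DecidableEq α]

theorem isFullCycle_iff_cycleType (hα : 2 ≤ Fintype.card α) (τ : Equiv.Perm α) :
    IsFullCycle τ ↔ τ.cycleType = {Fintype.card α} := by
  constructor
  · intro h
    have : Nontrivial α := Fintype.one_lt_card_iff_nontrivial.1 hα
    have hs : ∀ x, τ x ≠ x := by
      intro x hx
      obtain ⟨y, hy⟩ := exists_ne x
      exact hy ((Equiv.Perm.SameCycle.eq_of_left (h x y) hx).symm)
    have hsupp : τ.support = Finset.univ := by ext x; simp [hs x]
    have hc : τ.IsCycle := by
      obtain ⟨x⟩ := (inferInstance : Nonempty α)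
      exact ⟨x, hs x, fun y _ => h x y⟩
    rw [hc.cycleType, hsupp, Finset.card_univ]
  · intro h
    have hc : τ.IsCycle := by
      rw [← Equiv.Perm.card_cycleType_eq_one, h, Multiset.card_singleton]
    have hs : τ.support = Finset.univ := by
      rw [← Finset.card_eq_iff_eq_univ, ← Equiv.Perm.sum_cycleType, h, Multiset.sum_singleton]
    have hs' : ∀ x, τ x ≠ x := fun x => by
      rw [← Equiv.Perm.mem_support, hs]; exact Finset.mem_univ x
    exact fun x y => hc.sameCycle (hs' x) (hs' y)

theorem isFullCycle_iff_partition [Nonempty α] (τ : Equiv.Perm α) :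
    IsFullCycle τ ↔ τ.partition.parts = {Fintype.card α} := by
  rcases Nat.lt_or_ge (Fintype.card α) 2 with h | h
  · have h1 : Fintype.card α = 1 := by have := Fintype.card_pos (α := α); omega
    have : Subsingleton α := Fintype.card_le_one_iff_subsingleton.1 h1.le
    have h2 : τ = 1 := Subsingleton.elim _ _
    subst h2
    refine iff_of_true (fun x y => ?_) ?_
    · rw [Subsingleton.elim x y]
    · simp [Equiv.Perm.parts_partition, h1]
  · rw [isFullCycle_iff_cycleType h]
    constructor
    · intro h'
      have : τ.support.card = Fintype.card α := by
        rw [← Equiv.Perm.sum_cycleType, h', Multiset.sum_singleton]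
      simp [Equiv.Perm.parts_partition, h', this]
    · intro h'
      rw [← Equiv.Perm.filter_parts_partition_eq_cycleType, h', Multiset.filter_singleton, if_pos h]

theorem IsFullCycle.sign [Nonempty α] {τ : Equiv.Perm α} (h : IsFullCycle τ) :
    Equiv.Perm.sign τ = (-1) ^ (Fintype.card α - 1) := by
  rcases Nat.lt_or_ge (Fintype.card α) 2 with hc | hc
  · have h1 : Fintype.card α = 1 := by have := Fintype.card_pos (α := α); omega
    have : Subsingleton α := Fintype.card_le_one_iff_subsingleton.1 h1.le
    have h2 : τ = 1 := Subsingleton.elim _ _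
    simp [h2, h1]
  · rw [Equiv.Perm.sign_of_cycleType, (isFullCycle_iff_cycleType hc τ).1 h]
    obtain ⟨n, hn⟩ : ∃ n, Fintype.card α = n + 1 := ⟨_, (Nat.succ_pred_eq_of_pos (by omega)).symm⟩
    simp [hn, pow_add]

variable (α) in
/-- The full cycles of a finite type. -/
noncomputable def fullCycles : Finset (Equiv.Perm α) :=
  open Classical in Finset.univ.filter IsFullCycle

theorem mem_fullCycles {τ : Equiv.Perm α} : τ ∈ fullCycles α ↔ IsFullCycle τ := by
  simp [fullCycles]

theorem card_fullCycles [Nonempty α] : (fullCycles α).card = (Fintype.card α - 1)! := by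
  rcases Nat.lt_or_ge (Fintype.card α) 2 with hc | hc
  · have h1 : Fintype.card α = 1 := by have := Fintype.card_pos (α := α); omega
    have : Subsingleton α := Fintype.card_le_one_iff_subsingleton.1 h1.le
    have : fullCycles α = {1} := by
      ext τ
      rw [mem_fullCycles, Finset.mem_singleton]
      refine iff_of_true (fun x y => ?_) (Subsingleton.elim _ _)
      rw [Subsingleton.elim x y]
    simp [this, h1]
  · have : fullCycles α = Finset.univ.filter fun g => g.cycleType = {Fintype.card α} := by
      ext τ
      simp [mem_fullCycles, isFullCycle_iff_cycleType hc]
    rw [this, Equiv.Perm.card_of_cycleType, if_pos (by simpa using hc)]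
    obtain ⟨n, hn⟩ : ∃ n, Fintype.card α = n + 1 := ⟨_, (Nat.succ_pred_eq_of_pos (by omega)).symm⟩
    simp [hn, Nat.factorial_succ]

theorem maxCycles_eq {N : ℕ} (hN : 1 ≤ N) : maxCycles N = fullCycles (Fin N) := by
  have : Nonempty (Fin N) := ⟨⟨0, hN⟩⟩
  ext τ
  have h : ({Fintype.card (Fin N)} : Multiset ℕ) = {N} := by rw [Fintype.card_fin]
  rw [mem_fullCycles, isFullCycle_iff_partition, h, maxCycles, Finset.mem_filter]
  exact and_iff_right (Finset.mem_univ _)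

end FullCycles

/-! ### Merging two full cycles by a transposition. -/

section Splitting

variable {α : Type*} [Finite α] [DecidableEq α] {p : α → Prop} [DecidablePred p]

/-- The transposition joins the cycle of `f` through `a` to the cycle of `g` through `b` and leaves
every other cycle intact. -/
theorem isFullCycle_swap_mul_subtypeCongr {a b : α} (ha : p a) (hb : ¬ p b)
    (f : Equiv.Perm {x // p x}) (g : Equiv.Perm {x // ¬ p x}) :
    IsFullCycle (Equiv.swap a b * f.subtypeCongr g) ↔ IsFullCycle f ∧ IsFullCycle g := by
  have hab : a ≠ b := fun h => hb (h ▸ ha)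
  simp only [isFullCycle_iff_closed]
  have hl : ∀ x (hx : p x), f.subtypeCongr g x = f ⟨x, hx⟩ := fun x hx =>
    Equiv.Perm.subtypeCongr.left_apply _ _ hx
  have hr : ∀ x (hx : ¬ p x), f.subtypeCongr g x = g ⟨x, hx⟩ := fun x hx =>
    Equiv.Perm.subtypeCongr.right_apply _ _ hx
  have sl : ∀ x, p x → x ≠ a → Equiv.swap a b x = x := fun x hx h =>
    Equiv.swap_apply_of_ne_of_ne h (fun h' => hb (h' ▸ hx))
  have sr : ∀ x, ¬ p x → x ≠ b → Equiv.swap a b x = x := fun x hx h =>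
    Equiv.swap_apply_of_ne_of_ne (fun h' => hx (h' ▸ ha)) h
  have tl : ∀ x : {x // p x}, (f x).1 ≠ a → (Equiv.swap a b * f.subtypeCongr g) x = f x :=
    fun x hx => by rw [Equiv.Perm.mul_apply, hl x.1 x.2, sl _ (f x).2 hx]
  have tr : ∀ x : {x // ¬ p x}, (g x).1 ≠ b → (Equiv.swap a b * f.subtypeCongr g) x = g x :=
    fun x hx => by rw [Equiv.Perm.mul_apply, hr x.1 x.2, sr _ (g x).2 hx]
  have tla : ∀ x : {x // p x}, (f x).1 = a → (Equiv.swap a b * f.subtypeCongr g) x = b :=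
    fun x hx => by rw [Equiv.Perm.mul_apply, hl x.1 x.2, hx, Equiv.swap_apply_left]
  have trb : ∀ x : {x // ¬ p x}, (g x).1 = b → (Equiv.swap a b * f.subtypeCongr g) x = a :=
    fun x hx => by rw [Equiv.Perm.mul_apply, hr x.1 x.2, hx, Equiv.swap_apply_right]
  constructor
  · intro h
    constructor
    · intro P hP hne
      -- a closed set avoiding `a` would be closed for the whole permutation
      have key : ∀ Q : {x // p x} → Prop, (∀ x, Q x → Q (f x)) → (∃ x, Q x) → Q ⟨a, ha⟩ := by
        rintro Q hQ ⟨x, hx⟩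
        by_contra hQa
        obtain ⟨h1, _⟩ := h (fun y => ∃ hy : p y, Q ⟨y, hy⟩) (by
          rintro y ⟨hy, hQy⟩
          have h2 := hQ _ hQy
          rw [tl ⟨y, hy⟩ (fun h' => hQa (by rwa [← Subtype.ext_iff (a2 := ⟨a, ha⟩) |>.2 h']))]
          exact ⟨(f ⟨y, hy⟩).2, h2⟩) ⟨x, x.2, hx⟩ b
        exact hb h1
      by_contra hcon
      push Not at hcon
      -- The complement of `P` is closed too, so `P` and its complement would both contain `a`.
      refine key (fun x => ¬ P x) (fun x hx => ?_) hcon (key P hP hne)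
      intro hfx
      exact hx (of_closed_of_apply f hP hfx)
    · intro P hP hne
      have key : ∀ Q : {x // ¬ p x} → Prop, (∀ x, Q x → Q (g x)) → (∃ x, Q x) → Q ⟨b, hb⟩ := by
        rintro Q hQ ⟨x, hx⟩
        by_contra hQb
        obtain ⟨h1, _⟩ := h (fun y => ∃ hy : ¬ p y, Q ⟨y, hy⟩) (by
          rintro y ⟨hy, hQy⟩
          have h2 := hQ _ hQy
          rw [tr ⟨y, hy⟩ (fun h' => hQb (by rwa [← Subtype.ext_iff (a2 := ⟨b, hb⟩) |>.2 h']))]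
          exact ⟨(g ⟨y, hy⟩).2, h2⟩) ⟨x, x.2, hx⟩ a
        exact h1 ha
      by_contra hcon
      push Not at hcon
      refine key (fun x => ¬ P x) (fun x hx => ?_) hcon (key P hP hne)
      intro hfx
      exact hx (of_closed_of_apply g hP hfx)
  · rintro ⟨hf, hg⟩ P hP ⟨x₀, hx₀⟩
    have hfi : f (f⁻¹ ⟨a, ha⟩) = ⟨a, ha⟩ := by simp
    have hgi : g (g⁻¹ ⟨b, hb⟩) = ⟨b, hb⟩ := by simp
    -- The merged permutation leaves the block of `a` only at `f⁻¹ a`, which it sends to `b`. If `b`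
    -- were missed, the set would be closed under `f`, hence contain `f⁻¹ a`, hence `b`.
    have hPab : P a → P b := by
      intro hPa
      by_contra hPb
      have h1 : ∀ x : {x // p x}, P x := by
        refine hf (fun x => P x) (fun x hx => ?_) ⟨⟨a, ha⟩, hPa⟩
        by_cases h : (f x).1 = a
        · exact absurd (tla x h ▸ hP _ hx) hPb
        · exact tl x h ▸ hP _ hx
      exact hPb (tla (f⁻¹ ⟨a, ha⟩) (by rw [hfi]) ▸ hP _ (h1 _))
    have hPba : P b → P a := by
      intro hPb
      by_contra hPa
      have h1 : ∀ x : {x // ¬ p x}, P x := by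
        refine hg (fun x => P x) (fun x hx => ?_) ⟨⟨b, hb⟩, hPb⟩
        by_cases h : (g x).1 = b
        · exact absurd (trb x h ▸ hP _ hx) hPa
        · exact tr x h ▸ hP _ hx
      exact hPa (trb (g⁻¹ ⟨b, hb⟩) (by rw [hgi]) ▸ hP _ (h1 _))
    have cl : ∀ x : {x // p x}, P x → P (f x) := fun x hx => by
      by_cases h : (f x).1 = a
      · rw [h]; exact hPba (tla x h ▸ hP _ hx)
      · exact tl x h ▸ hP _ hx
    have cr : ∀ x : {x // ¬ p x}, P x → P (g x) := fun x hx => by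
      by_cases h : (g x).1 = b
      · rw [h]; exact hPab (trb x h ▸ hP _ hx)
      · exact tr x h ▸ hP _ hx
    have al : P a → ∀ x : {x // p x}, P x := fun h => hf (fun x => P x) cl ⟨⟨a, ha⟩, h⟩
    have ar : P b → ∀ x : {x // ¬ p x}, P x := fun h => hg (fun x => P x) cr ⟨⟨b, hb⟩, h⟩
    have hPa : P a := by
      by_cases h : p x₀
      · exact hf (fun x => P x) cl ⟨⟨x₀, h⟩, hx₀⟩ ⟨a, ha⟩
      · exact hPba (hg (fun x => P x) cr ⟨⟨x₀, h⟩, hx₀⟩ ⟨b, hb⟩)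
    intro x
    by_cases h : p x
    · exact al hPa ⟨x, h⟩
    · exact ar (hPab hPa) ⟨x, h⟩

end Splitting

/-! ### Determinants of maps and detection of full cycles. -/

section RowDet

variable {α : Type*} [Fintype α] [DecidableEq α]

/-- The determinant of the matrix whose row `i` is the unit vector at `g i`. -/
def rowDet (g : α → α) : ℝ := Matrix.det (Matrix.of fun i => Pi.single (g i) (1 : ℝ))

theorem rowDet_of_not_injective {g : α → α} (hg : ¬ Function.Injective g) : rowDet g = 0 := by
  simp only [Function.Injective, not_forall] at hg
  obtain ⟨x, y, h, hne⟩ := hg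
  refine Matrix.det_zero_of_row_eq hne ?_
  ext j
  simp [h]

theorem rowDet_comp (g : α → α) (κ : Equiv.Perm α) :
    rowDet (g ∘ κ) = (Equiv.Perm.sign κ : ℤ) * rowDet g :=
  Matrix.det_permute κ (Matrix.of fun i => Pi.single (g i) (1 : ℝ))

theorem rowDet_perm_comp (g : α → α) (κ : Equiv.Perm α) :
    rowDet (κ ∘ g) = (Equiv.Perm.sign κ : ℤ) * rowDet g := by
  rw [← Equiv.Perm.sign_inv, rowDet, rowDet, ← Matrix.det_permute']
  congr 1
  ext i j
  simp [Pi.single_apply, Equiv.eq_symm_apply, eq_comm]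

theorem rowDet_id : rowDet (id : α → α) = 1 := by
  rw [rowDet, ← Matrix.det_one (n := α)]
  congr 1
  ext i j
  simp [Matrix.one_apply, Pi.single_apply, eq_comm]

theorem rowDet_perm (κ : Equiv.Perm α) : rowDet κ = (Equiv.Perm.sign κ : ℤ) := by
  rw [← Function.comp_id κ, rowDet_perm_comp, rowDet_id, mul_one]

/-- Expansion of a determinant whose rows are combinations of two unit vectors. -/
theorem det_two_term_rows (f g : α → α) (t v : α → ℝ) :
    Matrix.det (Matrix.of fun i => t i • Pi.single (f i) (1 : ℝ) + v i • Pi.single (g i) (1 : ℝ)) =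
      ∑ S : Finset α, ((∏ i ∈ S, t i) * ∏ i ∈ Sᶜ, v i) * rowDet (S.piecewise f g) := by
  have h := (Matrix.detRowAlternating (n := α) (R := ℝ)).toMultilinearMap.map_add_univ
    (fun i => t i • Pi.single (f i) (1 : ℝ)) (fun i => v i • Pi.single (g i) (1 : ℝ))
  refine h.trans (Finset.sum_congr rfl fun S _ => ?_)
  have h2 : (S.piecewise (fun i => t i • (Pi.single (f i) (1 : ℝ) : α → ℝ))
      (fun i => v i • Pi.single (g i) (1 : ℝ))) =
      fun i => (S.piecewise t v i) • (Pi.single (S.piecewise f g i) (1 : ℝ) : α → ℝ) := by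
    funext i
    by_cases hi : i ∈ S <;> simp [hi]
  rw [h2, MultilinearMap.map_smul_univ, Finset.prod_piecewise, smul_eq_mul]
  rw [Finset.univ_inter, Finset.compl_eq_univ_sdiff]
  rfl

/-- A nonzero determinant makes the mixed map injective, so `σ(S)` avoids `τ(Sᶜ)` and lies in
`τ(S)`; cardinalities agree. -/
theorem image_eq_of_rowDet_ne_zero {σ τ : Equiv.Perm α} {S : Finset α}
    (h : rowDet (S.piecewise σ τ) ≠ 0) : S.image σ = S.image τ := by
  have hi : Function.Injective (S.piecewise σ τ) := not_not.1 fun hn => h (rowDet_of_not_injective hn)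
  refine Finset.eq_of_subset_of_card_le ?_ ?_
  · intro y hy
    obtain ⟨x, hx, rfl⟩ := Finset.mem_image.1 hy
    by_contra hn
    have hz : τ⁻¹ (σ x) ∉ S := fun hz => hn (Finset.mem_image.2 ⟨_, hz, by simp⟩)
    have := @hi x (τ⁻¹ (σ x)) (by
      rw [Finset.piecewise_eq_of_mem _ _ _ hx, Finset.piecewise_eq_of_notMem _ _ _ hz]
      simp)
    exact hz (this ▸ hx)
  · rw [Finset.card_image_of_injective _ σ.injective, Finset.card_image_of_injective _ τ.injective]

/-- The signed sum over subsets avoiding a point detects full cycles. -/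
theorem sum_rowDet_avoiding (σ τ : Equiv.Perm α) (x : α) :
    ∑ S : Finset α, (if x ∈ S then 0 else (-1 : ℝ) ^ S.card) * rowDet (S.piecewise σ τ) =
      open Classical in if IsFullCycle (σ * τ⁻¹) then ((Equiv.Perm.sign τ : ℤ) : ℝ) else 0 := by
  split_ifs with h
  -- A nonzero term has `σ(S) = τ(S)`, a set closed under `σ * τ⁻¹`. For a full cycle it is empty or
  -- everything, and `x ∉ S` excludes the latter.
  · rw [Finset.sum_eq_single ∅]
    · simp [rowDet_perm]
    · intro S _ hS
      split_ifs with hx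
      · simp
      rw [mul_eq_zero]
      right
      by_contra hne
      have him := image_eq_of_rowDet_ne_zero hne
      rw [isFullCycle_iff_closed] at h
      obtain ⟨s, hs⟩ := Finset.nonempty_iff_ne_empty.2 hS
      have := h (fun y => y ∈ S.image τ) (fun y hy => by
        obtain ⟨z, hz, rfl⟩ := Finset.mem_image.1 hy
        rw [← him]
        simpa using hz) ⟨τ s, Finset.mem_image_of_mem _ hs⟩ (τ x)
      obtain ⟨z, hz, hzx⟩ := Finset.mem_image.1 this
      exact hx (τ.injective hzx ▸ hz)
    · simp
  -- These weights make the sum a determinant with rows `e_(τ i) - e_(σ i)` and row `x` equal to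
  -- `e_(τ x)`.
  · have h1 := det_two_term_rows σ τ (fun i => if i = x then 0 else -1) (fun _ => 1)
    have h2 : ∀ S : Finset α, (∏ i ∈ S, if i = x then (0 : ℝ) else -1) =
        if x ∈ S then 0 else (-1 : ℝ) ^ S.card := by
      intro S
      split_ifs with hx
      · exact Finset.prod_eq_zero hx (by simp)
      · rw [Finset.prod_congr rfl (g := fun _ => (-1 : ℝ)), Finset.prod_const]
        intro i hi
        rw [if_neg]
        rintro rfl
        exact hx hi
    simp only [h2, Finset.prod_const_one, mul_one] at h1
    rw [← h1, ← Matrix.exists_mulVec_eq_zero_iff]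
    rw [IsFullCycle] at h
    have h' : ∃ z, ¬ (σ * τ⁻¹).SameCycle (τ x) z := by
      by_contra hc
      push Not at hc
      exact h fun y z => (hc y).symm.trans (hc z)
    obtain ⟨z, hz⟩ := h'
    classical
    -- Kernel vector: the indicator of the complement of the cycle through `τ x`. It takes equal
    -- values at `τ i` and `σ i`, and vanishes at `τ x`.
    refine ⟨fun y => if (σ * τ⁻¹).SameCycle (τ x) y then 0 else 1, fun h0 => ?_, ?_⟩
    · have := congrFun h0 z
      simp [hz] at this
    · have hinv : ∀ i, (σ * τ⁻¹).SameCycle (τ x) (σ i) ↔ (σ * τ⁻¹).SameCycle (τ x) (τ i) := by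
        intro i
        have : σ i = (σ * τ⁻¹) (τ i) := by simp
        rw [this, Equiv.Perm.sameCycle_apply_right]
      funext i
      rw [Matrix.mulVec]
      simp only [Matrix.of_apply, add_dotProduct, smul_dotProduct, single_dotProduct, one_mul,
        smul_eq_mul, hinv, Pi.zero_apply]
      by_cases hi : i = x
      · subst hi
        simp [Equiv.Perm.SameCycle.refl]
      · simp only [hi, if_false]
        split_ifs <;> simp

end RowDet

/-! ### Summing mixed determinants over all full cycles. -/

section CycleSums

variable {α : Type*} [DecidableEq α]

theorem exists_subtypeCongr_eq (θ : Equiv.Perm α) {S : Finset α} (h : S.image θ = S) :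
    ∃ (f : Equiv.Perm {x // x ∈ S}) (g : Equiv.Perm {x // x ∉ S}), f.subtypeCongr g = θ := by
  have h1 : ∀ x, θ x ∈ S ↔ x ∈ S := fun x => by
    conv_lhs => rw [← h]
    simp
  refine ⟨θ.subtypePerm h1, θ.subtypePerm (fun x => not_congr (h1 x)), ?_⟩
  ext x
  by_cases hx : x ∈ S
  · rw [Equiv.Perm.subtypeCongr.left_apply _ _ hx]; rfl
  · rw [Equiv.Perm.subtypeCongr.right_apply _ _ hx]; rfl

theorem image_subtypeCongr {S : Finset α} (f : Equiv.Perm {x // x ∈ S})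
    (g : Equiv.Perm {x // x ∉ S}) : S.image (f.subtypeCongr g) = S := by
  refine Finset.eq_of_subset_of_card_le ?_ ?_
  · intro y hy
    obtain ⟨x, hx, rfl⟩ := Finset.mem_image.1 hy
    rw [Equiv.Perm.subtypeCongr.left_apply _ _ hx]
    exact (f _).2
  · rw [Finset.card_image_of_injective _ (Equiv.injective _)]

theorem image_swap_sdiff {S : Finset α} {a b : α} (ha : a ∈ S) (hb : b ∉ S) :
    S \ S.image (Equiv.swap a b) = {a} := by
  ext x
  simp only [Finset.mem_sdiff, Finset.mem_image, not_exists, not_and, Finset.mem_singleton]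
  constructor
  · rintro ⟨hx, h⟩
    by_contra hxa
    exact h x hx (Equiv.swap_apply_of_ne_of_ne hxa (fun h' => hb (h' ▸ hx)))
  · rintro rfl
    refine ⟨ha, fun y hy h => hb ?_⟩
    rw [Equiv.swap_apply_eq_iff, Equiv.swap_apply_left] at h
    exact h ▸ hy

theorem image_swap_sdiff' {S : Finset α} {a b : α} (ha : a ∈ S) (hb : b ∉ S) :
    S.image (Equiv.swap a b) \ S = {b} := by
  ext x
  simp only [Finset.mem_sdiff, Finset.mem_image, Finset.mem_singleton]
  constructor
  · rintro ⟨⟨y, hy, rfl⟩, h⟩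
    by_cases hya : y = a
    · subst hya; simp
    · have hyb : y ≠ b := fun h' => hb (h' ▸ hy)
      rw [Equiv.swap_apply_of_ne_of_ne hya hyb] at h
      exact absurd hy h
  · rintro rfl
    exact ⟨⟨a, ha, by simp⟩, hb⟩

variable [Fintype α]

/-- The transposition fixes every argument off `S` and every value of `σ` on `S`, so conjugating `τ`
just postcomposes the mixed map with it. -/
theorem rowDet_piecewise_conj_swap (σ τ : Equiv.Perm α) {S : Finset α} {a b : α} (hab : a ≠ b)
    (ha : a ∈ S) (hb : b ∈ S) (ha' : a ∉ S.image σ) (hb' : b ∉ S.image σ) :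
    rowDet (S.piecewise σ (Equiv.swap a b * τ * (Equiv.swap a b)⁻¹ : Equiv.Perm α)) =
      -rowDet (S.piecewise σ τ) := by
  have : S.piecewise σ (Equiv.swap a b * τ * (Equiv.swap a b)⁻¹ : Equiv.Perm α) =
      Equiv.swap a b ∘ S.piecewise σ τ := by
    funext i
    by_cases hi : i ∈ S
    · have h1 : σ i ≠ a := fun h => ha' (h ▸ Finset.mem_image_of_mem σ hi)
      have h2 : σ i ≠ b := fun h => hb' (h ▸ Finset.mem_image_of_mem σ hi)
      simp [hi, Equiv.swap_apply_of_ne_of_ne h1 h2]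
    · have h1 : i ≠ a := fun h => hi (h ▸ ha)
      have h2 : i ≠ b := fun h => hi (h ▸ hb)
      simp [hi, Equiv.swap_apply_of_ne_of_ne h1 h2]
  rw [this, rowDet_perm_comp, Equiv.Perm.sign_swap hab]
  simp

theorem sum_fullCycles_rowDet_eq_zero (σ : Equiv.Perm α) {S : Finset α} {a b : α} (hab : a ≠ b)
    (ha : a ∈ S) (hb : b ∈ S) (ha' : a ∉ S.image σ) (hb' : b ∉ S.image σ) :
    ∑ τ ∈ fullCycles α, rowDet (S.piecewise σ τ) = 0 := by
  have h : ∑ τ ∈ fullCycles α, rowDet (S.piecewise σ τ) =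
      ∑ τ ∈ fullCycles α, -rowDet (S.piecewise σ τ) := by
    refine Finset.sum_nbij' (fun τ => Equiv.swap a b * τ * (Equiv.swap a b)⁻¹)
      (fun τ => Equiv.swap a b * τ * (Equiv.swap a b)⁻¹) ?_ ?_ ?_ ?_ ?_
    · exact fun τ hτ => mem_fullCycles.2 ((mem_fullCycles.1 hτ).conj _)
    · exact fun τ hτ => mem_fullCycles.2 ((mem_fullCycles.1 hτ).conj _)
    · intro τ _; ext x; simp
    · intro τ _; ext x; simp
    · intro τ _
      rw [rowDet_piecewise_conj_swap σ τ hab ha hb ha' hb', neg_neg]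
  rw [Finset.sum_neg_distrib] at h
  linarith

/-- The mixed map ignores `τ` on `S`, so `f` drops out and `g` acts by precomposition. -/
theorem rowDet_piecewise_swap_mul (σ : Equiv.Perm α) {S : Finset α} {a b : α}
    (f : Equiv.Perm {x // x ∈ S}) (g : Equiv.Perm {x // x ∉ S}) :
    rowDet (S.piecewise σ (Equiv.swap a b * f.subtypeCongr g : Equiv.Perm α)) =
      (Equiv.Perm.sign g : ℤ) * rowDet (S.piecewise σ (Equiv.swap a b)) := by
  have : S.piecewise σ (Equiv.swap a b * f.subtypeCongr g : Equiv.Perm α) =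
      S.piecewise σ (Equiv.swap a b) ∘
        (Equiv.Perm.subtypeCongr (1 : Equiv.Perm {x // x ∈ S}) g) := by
    funext i
    by_cases hi : i ∈ S
    · simp [hi, Equiv.Perm.subtypeCongr.left_apply _ _ hi]
    · have : (g ⟨i, hi⟩ : α) ∉ S := (g ⟨i, hi⟩).2
      simp [hi, Equiv.Perm.subtypeCongr.right_apply _ _ hi, this]
  rw [this, rowDet_comp, Equiv.Perm.sign_subtypeCongr]
  simp

/-- The `τ` in question are exactly the products of the transposition with a full cycle `f` of `S`
and a full cycle `g` of the complement; all contribute the same, because `sign g` depends only on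
the size. -/
theorem sum_filter_fullCycles_rowDet (σ : Equiv.Perm α) {S : Finset α} {a b : α}
    (ha : a ∈ S) (hb : b ∉ S) :
    ∑ τ ∈ (fullCycles α).filter (fun τ : Equiv.Perm α => S.image τ = S.image (Equiv.swap a b)),
        rowDet (S.piecewise σ τ) =
      ((S.card - 1)! * (Sᶜ.card - 1)! : ℕ) * (-1) ^ (Sᶜ.card - 1) *
        rowDet (S.piecewise σ (Equiv.swap a b)) := by
  have : Nonempty {x // x ∈ S} := ⟨⟨a, ha⟩⟩
  have : Nonempty {x // x ∉ S} := ⟨⟨b, hb⟩⟩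
  have hc1 : Fintype.card {x // x ∈ S} = S.card := by simp
  have hc2 : Fintype.card {x // x ∉ S} = Sᶜ.card := by
    rw [Fintype.card_subtype_compl, Finset.card_compl, hc1]
  have hcard : ((fullCycles {x // x ∈ S}) ×ˢ (fullCycles {x // x ∉ S})).card =
      (S.card - 1)! * (Sᶜ.card - 1)! := by
    rw [Finset.card_product, card_fullCycles, card_fullCycles, hc1, hc2]
  have hsum : ∑ q ∈ (fullCycles {x // x ∈ S}) ×ˢ (fullCycles {x // x ∉ S}),
      ((-1 : ℝ) ^ (Sᶜ.card - 1) * rowDet (S.piecewise σ (Equiv.swap a b))) =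
      ∑ τ ∈ (fullCycles α).filter (fun τ : Equiv.Perm α => S.image τ = S.image (Equiv.swap a b)),
        rowDet (S.piecewise σ τ) := by
    refine Finset.sum_bij (fun q _ => Equiv.swap a b * q.1.subtypeCongr q.2) ?_ ?_ ?_ ?_
    · rintro ⟨f, g⟩ hq
      rw [Finset.mem_product, mem_fullCycles, mem_fullCycles] at hq
      rw [Finset.mem_filter, mem_fullCycles]
      refine ⟨(isFullCycle_swap_mul_subtypeCongr ha hb f g).2 hq, ?_⟩
      rw [Equiv.Perm.coe_mul, ← Finset.image_image, image_subtypeCongr]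
    · rintro ⟨f, g⟩ _ ⟨f', g'⟩ _ h
      exact Equiv.Perm.subtypeCongrHom_injective (fun x => x ∈ S) (mul_left_cancel h)
    · intro τ hτ
      rw [Finset.mem_filter, mem_fullCycles] at hτ
      obtain ⟨f, g, hfg⟩ := exists_subtypeCongr_eq (Equiv.swap a b * τ) (S := S) (by
        rw [Equiv.Perm.coe_mul, ← Finset.image_image, hτ.2, Finset.image_image]
        ext x; simp)
      have hτ' : τ = Equiv.swap a b * f.subtypeCongr g := by
        rw [hfg, Equiv.swap_mul_self_mul]
      refine ⟨(f, g), ?_, hτ'.symm⟩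
      rw [Finset.mem_product, mem_fullCycles, mem_fullCycles]
      exact (isFullCycle_swap_mul_subtypeCongr ha hb f g).1 (hτ' ▸ hτ.1)
    · rintro ⟨f, g⟩ hq
      rw [Finset.mem_product, mem_fullCycles, mem_fullCycles] at hq
      rw [rowDet_piecewise_swap_mul, hq.2.sign, hc2]
      simp
  rw [← hsum, Finset.sum_const, hcard, nsmul_eq_mul]
  ring

/-- The signed sum over full cycles of the mixed determinants. -/
theorem sum_fullCycles_rowDet (σ : Equiv.Perm α) {S : Finset α} (hS : S.Nonempty)
    (hS' : Sᶜ.Nonempty) :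
    ∑ τ ∈ fullCycles α, rowDet (S.piecewise σ τ) =
      ((S.card - 1)! * (Sᶜ.card - 1)! : ℕ) * (-1) ^ (Sᶜ.card - 1) *
        ∑ a ∈ S, ∑ b ∈ Sᶜ, rowDet (S.piecewise σ (Equiv.swap a b)) := by
  have hz : ∀ a ∈ S, ∀ b ∈ Sᶜ, (S \ S.image σ ≠ {a} ∨ S.image σ \ S ≠ {b}) →
      rowDet (S.piecewise σ (Equiv.swap a b)) = 0 := by
    intro a ha b hb h
    by_contra hne
    rw [image_eq_of_rowDet_ne_zero hne] at h
    rw [Finset.mem_compl] at hb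
    rcases h with h | h
    · exact h (image_swap_sdiff ha hb)
    · exact h (image_swap_sdiff' ha hb)
  have hcard : (S \ S.image σ).card = (S.image σ \ S).card := by
    have h1 := Finset.card_sdiff_add_card_inter S (S.image σ)
    have h2 := Finset.card_sdiff_add_card_inter (S.image σ) S
    rw [Finset.card_image_of_injective _ σ.injective, Finset.inter_comm] at h2
    omega
  -- If `σ(S) = S`, a contributing full cycle would preserve the proper set `S`. If one point is
  -- exchanged, a single pair `(a, b)` contributes. If two or more leave, conjugation by a
  -- transposition cancels the sum.
  rcases Nat.lt_trichotomy (S \ S.image σ).card 1 with h | h | h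
  · have h0 : S \ S.image σ = ∅ := Finset.card_eq_zero.1 (by omega)
    rw [Finset.sum_eq_zero, Finset.sum_eq_zero, mul_zero]
    · intro a ha
      refine Finset.sum_eq_zero fun b hb => hz a ha b hb (Or.inl ?_)
      rw [h0]
      exact (Finset.singleton_ne_empty a).symm
    · intro τ hτ
      by_contra hne
      have him := image_eq_of_rowDet_ne_zero hne
      have hsub : S.image σ = S := Finset.eq_of_subset_of_card_le
        (Finset.sdiff_eq_empty_iff_subset.1 (Finset.card_eq_zero.1 (by omega)))
        (by rw [Finset.card_image_of_injective _ σ.injective])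
      rw [hsub] at him
      rw [mem_fullCycles, isFullCycle_iff_closed] at hτ
      obtain ⟨y, hy⟩ := hS'
      obtain ⟨s, hs⟩ := hS
      refine Finset.mem_compl.1 hy (hτ (fun x => x ∈ S) (fun x hx => ?_) ⟨s, hs⟩ y)
      rw [him]
      exact Finset.mem_image_of_mem _ hx
  · obtain ⟨a, ha⟩ := Finset.card_eq_one.1 h
    obtain ⟨b, hb⟩ := Finset.card_eq_one.1 (hcard ▸ h)
    have haS : a ∈ S := (Finset.mem_sdiff.1 (ha ▸ Finset.mem_singleton_self a)).1
    have hbS : b ∉ S := (Finset.mem_sdiff.1 (hb ▸ Finset.mem_singleton_self b)).2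
    rw [Finset.sum_eq_single a, Finset.sum_eq_single b, ← sum_filter_fullCycles_rowDet σ haS hbS,
      Finset.sum_filter_of_ne]
    · intro τ _ hne
      rw [← image_eq_of_rowDet_ne_zero hne]
      have key : ∀ U : Finset α, U = (S \ (S \ U)) ∪ (U \ S) := by
        intro U; ext x; simp only [Finset.mem_union, Finset.mem_sdiff]; tauto
      rw [key (S.image σ), key (S.image (Equiv.swap a b)), ha, hb, image_swap_sdiff haS hbS,
        image_swap_sdiff' haS hbS]
    · intro b' hb' hne
      refine hz a haS b' hb' (Or.inr ?_)
      rw [hb]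
      exact fun h => hne (Finset.singleton_injective h).symm
    · exact fun h => absurd (Finset.mem_compl.2 hbS) h
    · intro a' ha' hne
      refine Finset.sum_eq_zero fun b' hb' => hz a' ha' b' hb' (Or.inl ?_)
      rw [ha]
      exact fun h => hne (Finset.singleton_injective h).symm
    · exact fun h => absurd haS h
  · obtain ⟨a, ha, b, hb, hab⟩ := Finset.one_lt_card.1 h
    rw [Finset.mem_sdiff] at ha hb
    rw [sum_fullCycles_rowDet_eq_zero σ hab ha.1 hb.1 ha.2 hb.2, Finset.sum_eq_zero, mul_zero]
    intro a' ha'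
    refine Finset.sum_eq_zero fun b' hb' => hz a' ha' b' hb' (Or.inl fun h' => ?_)
    rw [h', Finset.card_singleton] at h
    omega

end CycleSums

/-- Integration by parts: `t ^ (a + 1) * (1 - t) ^ (b + 1)` vanishes at both ends, which trades `b +
1` for `b`. -/
theorem integral_pow_mul_one_sub_pow (a b : ℕ) :
    ∫ t in (0 : ℝ)..1, t ^ a * (1 - t) ^ b = (a ! * b ! : ℝ) / ((a + b + 1)! : ℝ) := by
  induction b generalizing a with
  | zero =>
    simp only [pow_zero, mul_one, integral_pow, Nat.factorial_zero, Nat.cast_one, add_zero,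
      Nat.factorial_succ]
    push_cast
    have : (a ! : ℝ) ≠ 0 := by positivity
    have : (a + 1 : ℝ) ≠ 0 := by positivity
    field_simp
    rw [one_pow, zero_pow (Nat.succ_ne_zero _), sub_zero]
  | succ b ih =>
    have hd : ∀ t : ℝ, HasDerivAt (fun t : ℝ => t ^ (a + 1) * (1 - t) ^ (b + 1))
        ((a + 1) * (t ^ a * (1 - t) ^ (b + 1)) - (b + 1) * (t ^ (a + 1) * (1 - t) ^ b)) t := by
      intro t
      have h1 : HasDerivAt (fun t : ℝ => 1 - t) (-1) t := by
        simpa using (hasDerivAt_id t).const_sub 1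
      refine ((hasDerivAt_pow (a + 1) t).fun_mul (h1.fun_pow (b + 1))).congr_deriv ?_
      simp only [add_tsub_cancel_right, Nat.cast_add, Nat.cast_one]
      ring
    have hi := intervalIntegral.integral_eq_sub_of_hasDerivAt (a := 0) (b := 1)
      (fun t _ => hd t) (Continuous.intervalIntegrable (by fun_prop) _ _)
    rw [intervalIntegral.integral_sub (Continuous.intervalIntegrable (by fun_prop) _ _)
      (Continuous.intervalIntegrable (by fun_prop) _ _), intervalIntegral.integral_const_mul,
      intervalIntegral.integral_const_mul, ih (a + 1)] at hi
    simp only [sub_self, ne_eq, Nat.add_eq_zero_iff, one_ne_zero, and_false, not_false_eq_true,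
      zero_pow, mul_zero, zero_mul] at hi
    have h2 : a + 1 + b + 1 = a + (b + 1) + 1 := by ring
    rw [h2] at hi
    have h3 : (a + 1 : ℝ) ≠ 0 := by positivity
    rw [← mul_right_inj' h3, sub_eq_zero.1 hi, Nat.factorial_succ a, Nat.factorial_succ b]
    push_cast
    ring

/-! ### Counting factorizations into two full cycles. -/

section Counting

variable {α : Type*} [Fintype α] [DecidableEq α]

open Classical in
/-- The number of factorizations of `σ` into two full cycles. -/
noncomputable def factorizationCount (σ : Equiv.Perm α) : ℕ :=
  ((fullCycles α).filter fun τ => IsFullCycle (σ * τ⁻¹)).card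

/-- The sum of the mixed determinants over all transpositions crossing the boundary of `S`. -/
noncomputable def crossSum (σ : Equiv.Perm α) (S : Finset α) : ℝ :=
  ∑ a ∈ S, ∑ b ∈ Sᶜ, rowDet (S.piecewise σ (Equiv.swap a b))

theorem sum_point_weights (S : Finset α) :
    ∑ x, (if x ∈ S then 0 else (-1 : ℝ) ^ S.card) = Sᶜ.card * (-1) ^ S.card := by
  rw [Finset.sum_ite, Finset.sum_const_zero, zero_add, Finset.sum_const, nsmul_eq_mul]
  congr 3
  ext x; simp

/-- Averaging the detection identity over the base point `x` makes the weight of `S` depend only on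
its size; `(-1) ^ (Fintype.card α - 1)` cancels `sign τ`. -/
theorem card_mul_factorizationCount_aux [Nonempty α] (σ : Equiv.Perm α) :
    (Fintype.card α : ℝ) * factorizationCount σ =
      ∑ S : Finset α, (-1) ^ (Fintype.card α - 1) * (Sᶜ.card * (-1) ^ S.card) *
        ∑ τ ∈ fullCycles α, rowDet (S.piecewise σ τ) := by
  have h1 : ∀ x : α, (factorizationCount σ : ℝ) = ∑ τ ∈ fullCycles α,
      ∑ S : Finset α, (-1) ^ (Fintype.card α - 1) *
        ((if x ∈ S then 0 else (-1 : ℝ) ^ S.card) * rowDet (S.piecewise σ τ)) := by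
    intro x
    rw [factorizationCount, Finset.card_filter]
    push_cast
    refine Finset.sum_congr rfl fun τ hτ => ?_
    rw [← Finset.mul_sum, sum_rowDet_avoiding, (mem_fullCycles.1 hτ).sign]
    split_ifs
    · push_cast
      rw [← mul_pow]
      simp
    · simp
  have h2 : (Fintype.card α : ℝ) * factorizationCount σ = ∑ _x : α, (factorizationCount σ : ℝ) := by
    rw [Finset.sum_const, Finset.card_univ, nsmul_eq_mul]
  rw [h2, Finset.sum_congr rfl fun x _ => h1 x]
  rw [Finset.sum_comm' (t' := fullCycles α) (s' := fun _ => Finset.univ) (by simp)]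
  rw [Finset.sum_congr rfl fun τ _ => Finset.sum_comm, Finset.sum_comm]
  refine Finset.sum_congr rfl fun S _ => ?_
  rw [Finset.mul_sum]
  refine Finset.sum_congr rfl fun τ _ => ?_
  rw [← Finset.mul_sum, ← Finset.sum_mul, sum_point_weights]
  ring

/-- The empty set gives the factorial. For other `S` all signs cancel and `Sᶜ.card` completes
`(Sᶜ.card - 1)!`. The truncated `S.card - 1` is harmless, since `crossSum σ ∅ = 0`. -/
theorem card_mul_factorizationCount [Nonempty α] (σ : Equiv.Perm α) :
    (Fintype.card α : ℝ) * factorizationCount σ = ((Fintype.card α)! : ℝ) +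
      ∑ S : Finset α, ((S.card - 1)! * Sᶜ.card ! : ℝ) * crossSum σ S := by
  have hN : Fintype.card α = (Fintype.card α - 1) + 1 :=
    (Nat.succ_pred_eq_of_pos Fintype.card_pos).symm
  have h0 : ((Fintype.card α)! : ℝ) =
      ∑ S : Finset α, if S = ∅ then ((Fintype.card α)! : ℝ) else 0 := by simp
  rw [card_mul_factorizationCount_aux, h0, ← Finset.sum_add_distrib]
  refine Finset.sum_congr rfl fun S _ => ?_
  rcases S.eq_empty_or_nonempty with rfl | hS
  · have : ∑ τ ∈ fullCycles α, rowDet ((∅ : Finset α).piecewise σ τ) =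
        (Fintype.card α - 1)! * (-1) ^ (Fintype.card α - 1) := by
      rw [← card_fullCycles, ← nsmul_eq_mul, ← Finset.sum_const]
      refine Finset.sum_congr rfl fun τ hτ => ?_
      rw [Finset.piecewise_empty, rowDet_perm, (mem_fullCycles.1 hτ).sign]
      simp
    rw [this, crossSum]
    simp only [Finset.compl_empty, Finset.card_univ, Finset.card_empty, pow_zero, mul_one, if_true,
      Finset.sum_empty, mul_zero, add_zero]
    have h4 : ((-1 : ℝ) ^ (Fintype.card α - 1)) * (-1) ^ (Fintype.card α - 1) = 1 := by
      rw [← mul_pow]; simp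
    have h5 : ((Fintype.card α)! : ℝ) = Fintype.card α * ((Fintype.card α - 1)! : ℝ) := by
      rw [← Nat.cast_mul, Nat.mul_factorial_pred Fintype.card_ne_zero]
    rw [h5]
    linear_combination (Fintype.card α : ℝ) * ((Fintype.card α - 1)! : ℝ) * h4
  · rw [if_neg hS.ne_empty, zero_add]
    rcases Sᶜ.eq_empty_or_nonempty with hS' | hS'
    · simp [crossSum, hS']
    · rw [sum_fullCycles_rowDet σ hS hS', ← crossSum]
      have hc : S.card + Sᶜ.card = Fintype.card α := Finset.card_add_card_compl S
      obtain ⟨k, hk⟩ : ∃ k, S.card = k + 1 := ⟨_, (Nat.succ_pred_eq_of_pos hS.card_pos).symm⟩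
      obtain ⟨m, hm⟩ : ∃ m, Sᶜ.card = m + 1 := ⟨_, (Nat.succ_pred_eq_of_pos hS'.card_pos).symm⟩
      have hN' : Fintype.card α - 1 = k + 1 + m := by omega
      rw [hk, hm, hN']
      simp only [add_tsub_cancel_right, Nat.factorial_succ m]
      push_cast
      have h4 : ((-1 : ℝ) ^ (k + 1 + m)) * (-1) ^ (k + 1) * (-1) ^ m = 1 := by
        rw [mul_assoc, ← pow_add, ← mul_pow]; simp
      linear_combination ((m + 1 : ℝ) * k ! * m ! * crossSum σ S) * h4

/-! ### The interpolating matrix, its determinant and its adjugate. -/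

/-- The matrix `(1 - t) + t P`, where `P` is the permutation matrix of `σ`. -/
noncomputable def lazyMatrix (σ : Equiv.Perm α) (t : ℝ) : Matrix α α ℝ :=
  Matrix.of fun i => t • Pi.single (σ i) (1 : ℝ) + (1 - t) • Pi.single i (1 : ℝ)

theorem det_lazyMatrix (σ : Equiv.Perm α) (t : ℝ) :
    (lazyMatrix σ t).det =
      ∑ S : Finset α, t ^ S.card * (1 - t) ^ Sᶜ.card * rowDet (S.piecewise σ id) := by
  have : (lazyMatrix σ t).det = _ := det_two_term_rows σ id (fun _ => t) (fun _ => 1 - t)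
  simpa only [Finset.prod_const] using this

/-- This entry is the determinant with row `b` replaced by `e_a`. That row has weight `1` and is
never a `σ` row, whence `b ∉ S` and the exponent `Sᶜ.card - 1`. -/
theorem adjugate_lazyMatrix (σ : Equiv.Perm α) (t : ℝ) (a b : α) :
    (lazyMatrix σ t).adjugate a b = ∑ S : Finset α, (if b ∈ S then 0 else
      t ^ S.card * (1 - t) ^ (Sᶜ.card - 1) * rowDet (S.piecewise σ (Function.update id b a))) := by
  have h := det_two_term_rows σ (Function.update id b a) (fun i => if i = b then 0 else t)
    (fun i => if i = b then 1 else 1 - t)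
  have hM : (lazyMatrix σ t).updateRow b (Pi.single a 1) =
      Matrix.of fun i => (if i = b then 0 else t) • Pi.single (σ i) (1 : ℝ) +
        (if i = b then 1 else 1 - t) • Pi.single (Function.update id b a i) (1 : ℝ) := by
    ext i j
    by_cases hi : i = b
    · subst hi; simp
    · simp [hi, lazyMatrix]
  rw [Matrix.adjugate_apply, hM, h]
  refine Finset.sum_congr rfl fun S _ => ?_
  split_ifs with hb
  · rw [Finset.prod_eq_zero hb (by simp)]; simp
  · congr 2
    · rw [Finset.prod_congr rfl (g := fun _ => t), Finset.prod_const]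
      intro i hi
      rw [if_neg]
      rintro rfl
      exact hb hi
    · have hb' : b ∈ Sᶜ := Finset.mem_compl.2 hb
      rw [← Finset.mul_prod_erase _ _ hb', if_pos rfl, one_mul,
        Finset.prod_congr rfl (g := fun _ => 1 - t), Finset.prod_const,
        Finset.card_erase_of_mem hb']
      intro i hi
      rw [if_neg (Finset.ne_of_mem_erase hi)]

/-- The rows sum to `1`, so the all-ones vector is fixed by the matrix and multiplied by the
determinant under the adjugate. -/
theorem sum_adjugate_lazyMatrix (σ : Equiv.Perm α) (t : ℝ) :
    ∑ a, ∑ b, (lazyMatrix σ t).adjugate a b = Fintype.card α * (lazyMatrix σ t).det := by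
  have h1 : (lazyMatrix σ t).mulVec 1 = 1 := by
    funext i
    change (t • Pi.single (σ i) (1 : ℝ) + (1 - t) • Pi.single i (1 : ℝ)) ⬝ᵥ 1 = 1
    rw [add_dotProduct, smul_dotProduct,
      smul_dotProduct, single_dotProduct, single_dotProduct]
    simp
  have h2 : (lazyMatrix σ t).adjugate.mulVec 1 = (lazyMatrix σ t).det • (1 : α → ℝ) := by
    conv_lhs => rw [← h1]
    rw [Matrix.mulVec_mulVec, Matrix.adjugate_mul, Matrix.smul_mulVec, Matrix.one_mulVec]
  have h3 : ∀ a, ∑ b, (lazyMatrix σ t).adjugate a b = (lazyMatrix σ t).det := by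
    intro a
    have := congrFun h2 a
    simpa [Matrix.mulVec, dotProduct] using this
  rw [Finset.sum_congr rfl fun a _ => h3 a, Finset.sum_const, Finset.card_univ, nsmul_eq_mul]

/-- Off `S` a transposition with `a ∈ S` moves only `b`; if `a ≠ b` are both off `S`, rows `a` and
`b` coincide. -/
theorem rowDet_piecewise_update (σ : Equiv.Perm α) {S : Finset α} {a b : α} (hb : b ∉ S) :
    rowDet (S.piecewise σ (Function.update id b a)) =
      if a = b then rowDet (S.piecewise σ id) else
        if a ∈ S then rowDet (S.piecewise σ (Equiv.swap a b)) else 0 := by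
  split_ifs with hab ha
  · subst hab
    rw [show Function.update id a a = id from Function.update_eq_self a id]
  · congr 1
    refine S.piecewise_congr (fun _ _ => rfl) fun i hi => ?_
    by_cases hib : i = b
    · subst hib; simp
    · have hia : i ≠ a := fun h => hi (h ▸ ha)
      rw [Equiv.swap_apply_of_ne_of_ne hia hib, Function.update_of_ne hib, id]
  · refine rowDet_of_not_injective fun hi => hab (@hi a b ?_)
    simp [ha, hb, Function.update_of_ne hab]

/-- The entry sum of the adjugate, computed twice. Diagonal entries give `Sᶜ.card` copies of the
identity term, off-diagonal ones give `crossSum`; a factor `1 - t` restores the exponent `Sᶜ.card`.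
-/
theorem sum_crossSum (σ : Equiv.Perm α) (t : ℝ) :
    ∑ S : Finset α, t ^ S.card * (1 - t) ^ Sᶜ.card * crossSum σ S =
      ∑ S : Finset α, t ^ S.card * (1 - t) ^ Sᶜ.card *
        (S.card * (1 - t) - Sᶜ.card * t) * rowDet (S.piecewise σ id) := by
  have h := sum_adjugate_lazyMatrix σ t
  simp only [adjugate_lazyMatrix] at h
  rw [Finset.sum_congr rfl fun a _ => Finset.sum_comm, Finset.sum_comm, det_lazyMatrix,
    Finset.mul_sum] at h
  have h1 : ∀ S : Finset α, ∑ a, ∑ b, (if b ∈ S then 0 else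
      t ^ S.card * (1 - t) ^ (Sᶜ.card - 1) * rowDet (S.piecewise σ (Function.update id b a))) =
      t ^ S.card * (1 - t) ^ (Sᶜ.card - 1) *
        (Sᶜ.card * rowDet (S.piecewise σ id) + crossSum σ S) := by
    intro S
    have h2 : ∀ a b, (if b ∈ S then 0 else t ^ S.card * (1 - t) ^ (Sᶜ.card - 1) *
        rowDet (S.piecewise σ (Function.update id b a))) =
        t ^ S.card * (1 - t) ^ (Sᶜ.card - 1) *
          ((if a = b then (if b ∈ Sᶜ then rowDet (S.piecewise σ id) else 0) else 0) +
          (if a ∈ S then (if b ∈ Sᶜ then rowDet (S.piecewise σ (Equiv.swap a b)) else 0)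
            else 0)) := by
      intro a b
      by_cases hb : b ∈ S
      · simp [hb]
      · rw [if_neg hb, rowDet_piecewise_update σ hb]
        by_cases hab : a = b
        · subst hab; simp [hb]
        · simp [hb, hab]
    simp only [h2, ← Finset.mul_sum, Finset.sum_add_distrib]
    congr 2
    · simp only [Finset.sum_ite_eq, Finset.mem_univ, if_true]
      rw [Finset.sum_ite_mem, Finset.univ_inter, Finset.sum_const, nsmul_eq_mul]
    · rw [crossSum, ← Finset.univ_inter S, ← Finset.sum_ite_mem, Finset.univ_inter]
      refine Finset.sum_congr rfl fun a _ => ?_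
      split_ifs
      · rw [Finset.sum_ite_mem, Finset.univ_inter]
      · simp
  rw [Finset.sum_congr rfl fun S _ => h1 S] at h
  have h3 : ∀ S : Finset α, (1 - t) * (t ^ S.card * (1 - t) ^ (Sᶜ.card - 1) *
      (Sᶜ.card * rowDet (S.piecewise σ id) + crossSum σ S)) =
      t ^ S.card * (1 - t) ^ Sᶜ.card *
        (Sᶜ.card * rowDet (S.piecewise σ id) + crossSum σ S) := by
    intro S
    rcases Sᶜ.eq_empty_or_nonempty with hS | hS
    · simp [crossSum, hS]
    · conv_rhs => rw [← Nat.succ_pred_eq_of_pos hS.card_pos, Nat.succ_eq_add_one, pow_succ]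
      rw [Nat.pred_eq_sub_one]
      push_cast [Nat.cast_sub (Nat.one_le_iff_ne_zero.2 hS.card_ne_zero)]
      ring
  have h4 := congrArg (fun z => (1 - t) * z) h
  simp only [Finset.mul_sum] at h4
  rw [Finset.sum_congr rfl fun S _ => h3 S] at h4
  simp only [mul_add, Finset.sum_add_distrib] at h4
  rw [eq_sub_of_add_eq' h4, ← Finset.sum_sub_distrib]
  refine Finset.sum_congr rfl fun S _ => ?_
  rw [← Finset.card_add_card_compl S]
  push_cast
  ring

theorem integral_crossSum (σ : Equiv.Perm α) [Nonempty α] :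
    ∫ t in (0 : ℝ)..1, ∑ S : Finset α, t ^ (S.card - 1) * (1 - t) ^ Sᶜ.card * crossSum σ S =
      (∫ t in (0 : ℝ)..1, (lazyMatrix σ t).det) - 1 := by
  -- After division by `t`, the right side of `sum_crossSum` is the determinant plus this
  -- derivative. The primitive is `1` at `0` (only `S = ∅` survives) and `0` at `1`.
  have hd : ∀ t : ℝ, HasDerivAt (fun t : ℝ => ∑ S : Finset α,
      t ^ S.card * (1 - t) ^ (Sᶜ.card + 1) * rowDet (S.piecewise σ id))
      (∑ S : Finset α, (S.card * t ^ (S.card - 1) * (1 - t) ^ (Sᶜ.card + 1) -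
        t ^ S.card * ((Sᶜ.card + 1) * (1 - t) ^ Sᶜ.card)) * rowDet (S.piecewise σ id)) t := by
    intro t
    refine HasDerivAt.fun_sum fun S _ => HasDerivAt.mul_const ?_ _
    have h1 : HasDerivAt (fun t : ℝ => 1 - t) (-1) t := by
      simpa using (hasDerivAt_id t).const_sub 1
    refine ((hasDerivAt_pow S.card t).fun_mul (h1.fun_pow (Sᶜ.card + 1))).congr_deriv ?_
    simp only [add_tsub_cancel_right, Nat.cast_add, Nat.cast_one]
    ring
  have hi := intervalIntegral.integral_eq_sub_of_hasDerivAt (a := 0) (b := 1)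
    (fun t _ => hd t) (Continuous.intervalIntegrable (by fun_prop) _ _)
  have h0 : ∑ S : Finset α, (0 : ℝ) ^ S.card * (1 - 0) ^ (Sᶜ.card + 1) *
      rowDet (S.piecewise σ id) = 1 := by
    rw [Finset.sum_eq_single ∅]
    · simp [rowDet_id]
    · intro S _ hS
      simp [hS]
    · simp
  simp only [h0, sub_self, ne_eq, Nat.add_eq_zero_iff, one_ne_zero, and_false, not_false_eq_true,
    zero_pow, mul_zero, zero_mul, Finset.sum_const_zero, zero_sub] at hi
  have hdet : Continuous fun t => (lazyMatrix σ t).det := by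
    simp only [det_lazyMatrix]
    fun_prop
  rw [sub_eq_add_neg, ← hi, ← intervalIntegral.integral_add (hdet.intervalIntegrable _ _)
    (Continuous.intervalIntegrable (by fun_prop) _ _)]
  refine intervalIntegral.integral_congr_ae (Filter.Eventually.of_forall fun t ht => ?_)
  rw [Set.uIoc_of_le zero_le_one] at ht
  have ht0 : t ≠ 0 := ht.1.ne'
  rw [← mul_right_inj' ht0, det_lazyMatrix, ← Finset.sum_add_distrib, Finset.mul_sum,
    Finset.mul_sum]
  refine Eq.trans ?_ ((sum_crossSum σ t).trans ?_)
  · refine Finset.sum_congr rfl fun S _ => ?_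
    rcases S.eq_empty_or_nonempty with rfl | hS
    · simp [crossSum]
    · conv_rhs => rw [← Nat.sub_add_cancel hS.card_pos, pow_succ]
      ring
  · refine Finset.sum_congr rfl fun S _ => ?_
    rcases Nat.eq_zero_or_pos S.card with hS | hS
    · simp only [hS]
      push_cast
      ring
    · obtain ⟨k, hk⟩ : ∃ k, S.card = k + 1 := ⟨_, (Nat.succ_pred_eq_of_pos hS).symm⟩
      rw [hk]
      simp only [add_tsub_cancel_right]
      push_cast
      ring

/-- The number of factorizations of a permutation into two full cycles. -/
theorem factorizationCount_eq [Nonempty α] (σ : Equiv.Perm α) :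
    (factorizationCount σ : ℝ) =
      ((Fintype.card α - 1)! : ℝ) * ∫ t in (0 : ℝ)..1, (lazyMatrix σ t).det := by
  have hN : (Fintype.card α : ℝ) ≠ 0 := Nat.cast_ne_zero.2 Fintype.card_ne_zero
  rw [← mul_right_inj' hN, card_mul_factorizationCount, ← mul_assoc, ← Nat.cast_mul,
    Nat.mul_factorial_pred Fintype.card_ne_zero, ← sub_add_cancel (∫ t in (0 : ℝ)..1, _) 1,
    ← integral_crossSum, mul_add, mul_one, add_comm, add_left_inj,
    intervalIntegral.integral_finsetSum
      (fun S _ => Continuous.intervalIntegrable (by fun_prop) _ _), Finset.mul_sum]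
  -- The constant terms have cancelled; the remaining factorials are the Beta integral times
  -- `(Fintype.card α)!`.
  refine Finset.sum_congr rfl fun S _ => ?_
  rw [intervalIntegral.integral_mul_const, integral_pow_mul_one_sub_pow]
  rcases S.eq_empty_or_nonempty with rfl | hS
  · simp [crossSum]
  · have : S.card - 1 + Sᶜ.card + 1 = Fintype.card α := by
      have := Finset.card_add_card_compl S
      have := hS.card_pos
      omega
    rw [this]
    have h : ((Fintype.card α)! : ℝ) ≠ 0 := by positivity
    field_simp

end Counting

/-! ### Permutations with equal cycle lengths and the probability. -/

section EqualCycles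

/-- A full cycle has no proper nonempty invariant set, so only the empty and the full set survive in
the expansion. -/
theorem det_lazyMatrix_of_isFullCycle {α : Type*} [Fintype α] [DecidableEq α] [Nonempty α]
    {τ : Equiv.Perm α} (h : IsFullCycle τ) (t : ℝ) :
    (lazyMatrix τ t).det = (1 - t) ^ Fintype.card α - (-t) ^ Fintype.card α := by
  rw [det_lazyMatrix, ← Finset.add_sum_erase _ _ (Finset.mem_univ ∅),
    Finset.sum_eq_single Finset.univ]
  · simp only [Finset.card_empty, pow_zero, one_mul, Finset.compl_empty, Finset.card_univ,
      Finset.piecewise_empty, rowDet_id, mul_one, Finset.compl_univ, Finset.piecewise_univ,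
      rowDet_perm, h.sign]
    conv_rhs => rw [neg_pow t]
    obtain ⟨n, hn⟩ : ∃ n, Fintype.card α = n + 1 :=
      ⟨_, (Nat.succ_pred_eq_of_pos Fintype.card_pos).symm⟩
    rw [hn]
    push_cast
    ring
  · intro S hS hne
    have hne' : S.Nonempty := Finset.nonempty_iff_ne_empty.2 (Finset.ne_of_mem_erase hS)
    by_contra h0
    have him := image_eq_of_rowDet_ne_zero (σ := τ) (τ := 1) (right_ne_zero_of_mul h0)
    rw [Equiv.Perm.coe_one, Finset.image_id] at him
    refine hne (Finset.eq_univ_iff_forall.2 ?_)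
    refine (isFullCycle_iff_closed τ).1 h (fun x => x ∈ S) (fun x hx => ?_) hne'
    rw [← him]
    exact Finset.mem_image_of_mem _ hx
  · intro h'
    exact absurd (Finset.mem_erase.2 ⟨Finset.univ_nonempty.ne_empty, Finset.mem_univ _⟩) h'

variable {N : ℕ}

/-- As `r ≥ 2`, fixed points are excluded, so the cycle type accounts for all `N` points. -/
theorem allCyclesHaveLength_iff {r : ℕ} (hr : 2 ≤ r) (σ : Equiv.Perm (Fin N)) :
    AllCyclesHaveLength r σ ↔ r ∣ N ∧ σ.cycleType = Multiset.replicate (N / r) r := by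
  have hle : σ.support.card ≤ N := by simpa using σ.support.card_le_univ
  rw [AllCyclesHaveLength, cycleLengths, Equiv.Perm.parts_partition, Fintype.card_fin]
  constructor
  · intro h
    have h1 : σ.support.card = N := by
      by_contra hne
      have := h 1 (Multiset.mem_add.2 (Or.inr (Multiset.mem_replicate.2 ⟨by omega, rfl⟩)))
      omega
    have h2 : σ.cycleType = Multiset.replicate (Multiset.card σ.cycleType) r :=
      Multiset.eq_replicate.2 ⟨rfl, fun b hb => h b (Multiset.mem_add.2 (Or.inl hb))⟩
    have h3 : Multiset.card σ.cycleType * r = N := by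
      have h4 := σ.sum_cycleType
      rwa [h2, Multiset.sum_replicate, smul_eq_mul, h1] at h4
    refine ⟨⟨_, (mul_comm r _ ▸ h3).symm⟩, ?_⟩
    rwa [Nat.div_eq_of_eq_mul_left (by omega) h3.symm]
  · rintro ⟨hd, h⟩ m hm
    have h1 : σ.support.card = N := by
      rw [← Equiv.Perm.sum_cycleType, h, Multiset.sum_replicate, smul_eq_mul, Nat.div_mul_cancel hd]
    rw [h1, h, Nat.sub_self, Multiset.replicate_zero, add_zero] at hm
    exact Multiset.eq_of_mem_replicate hm

/-- A representative of the cycle of `σ` through `i`. -/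
noncomputable def cycleRep (σ : Equiv.Perm (Fin N)) (i : Fin N) : Fin N :=
  (Quotient.mk (Equiv.Perm.SameCycle.setoid σ) i).out

theorem sameCycle_cycleRep (σ : Equiv.Perm (Fin N)) (i : Fin N) : σ.SameCycle (cycleRep σ i) i :=
  Quotient.mk_out (s := Equiv.Perm.SameCycle.setoid σ) i

theorem cycleRep_eq_iff (σ : Equiv.Perm (Fin N)) (i j : Fin N) :
    cycleRep σ i = cycleRep σ j ↔ σ.SameCycle i j := by
  constructor
  · intro h
    exact (sameCycle_cycleRep σ i).symm.trans (h ▸ sameCycle_cycleRep σ j)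
  · intro h
    exact congrArg Quotient.out (Quotient.sound (s := Equiv.Perm.SameCycle.setoid σ) h)

theorem cycleRep_apply (σ : Equiv.Perm (Fin N)) (i : Fin N) :
    cycleRep σ (σ i) = cycleRep σ i :=
  (cycleRep_eq_iff σ _ _).2 (Equiv.Perm.sameCycle_apply_left.2 (Equiv.Perm.SameCycle.refl _ _))

/-- Row `i` lives on `i` and `σ i`, which share a cycle: the matrix is in fact block diagonal, and
the order of the representatives is immaterial. -/
theorem blockTriangular_lazyMatrix (σ : Equiv.Perm (Fin N)) (t : ℝ) :
    (lazyMatrix σ t).BlockTriangular (cycleRep σ) := by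
  intro i j hij
  have h1 : j ≠ i := by rintro rfl; exact lt_irrefl _ hij
  have h2 : j ≠ σ i := by
    rintro rfl
    rw [cycleRep_apply] at hij
    exact lt_irrefl _ hij
  simp [lazyMatrix, h1, h2]

theorem card_cycleRep_fiber {r m : ℕ} {σ : Equiv.Perm (Fin N)}
    (h : σ.cycleType = Multiset.replicate m r) (hm : m * r = N) (i : Fin N) :
    (Finset.univ.filter fun j => cycleRep σ j = cycleRep σ i).card = r := by
  have hs : σ.support = Finset.univ := by
    rw [← Finset.card_eq_iff_eq_univ, ← Equiv.Perm.sum_cycleType, h]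
    simp [hm]
  have hi : i ∈ σ.support := hs ▸ Finset.mem_univ i
  have h1 : (Finset.univ.filter fun j => cycleRep σ j = cycleRep σ i) = (σ.cycleOf i).support := by
    ext j
    rw [Equiv.Perm.mem_support_cycleOf_iff, Finset.mem_filter, cycleRep_eq_iff]
    simp [hi, Equiv.Perm.sameCycle_comm]
  rw [h1]
  have h2 : (σ.cycleOf i).support.card ∈ σ.cycleType := by
    rw [Equiv.Perm.cycleType_def]
    exact Multiset.mem_map_of_mem _ (Equiv.Perm.cycleOf_mem_cycleFactorsFinset_iff.2 hi)
  rw [h] at h2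
  exact Multiset.eq_of_mem_replicate h2

theorem det_lazyMatrix_of_cycleType {r m : ℕ} (hr : 2 ≤ r) {σ : Equiv.Perm (Fin N)}
    (h : σ.cycleType = Multiset.replicate m r) (hm : m * r = N) (t : ℝ) :
    (lazyMatrix σ t).det = ((1 - t) ^ r - (-t) ^ r) ^ m := by
  have hblock : ∀ a ∈ Finset.univ.image (cycleRep σ),
      ((lazyMatrix σ t).toSquareBlock (cycleRep σ) a).det = (1 - t) ^ r - (-t) ^ r := by
    intro a ha
    obtain ⟨i, _, rfl⟩ := Finset.mem_image.1 ha
    have : Nonempty {j // cycleRep σ j = cycleRep σ i} := ⟨⟨i, rfl⟩⟩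
    have hinv : ∀ j, cycleRep σ (σ j) = cycleRep σ i ↔ cycleRep σ j = cycleRep σ i := fun j => by
      rw [cycleRep_apply]
    have hM : (lazyMatrix σ t).toSquareBlock (cycleRep σ) (cycleRep σ i) =
        lazyMatrix (σ.subtypePerm hinv) t := by
      ext j k
      simp [lazyMatrix, Matrix.toSquareBlock_def, Pi.single_apply, Subtype.ext_iff]
    have hfull : IsFullCycle
        (σ.subtypePerm hinv : Equiv.Perm {j // cycleRep σ j = cycleRep σ i}) := fun x y => by
      exact Equiv.Perm.sameCycle_subtypePerm.2 ((cycleRep_eq_iff _ _ _).1 (x.2.trans y.2.symm))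
    rw [hM, det_lazyMatrix_of_isFullCycle hfull, Fintype.card_subtype,
      card_cycleRep_fiber h hm]
  have hcard : (Finset.univ.image (cycleRep σ)).card = m := by
    have h1 := Finset.card_eq_sum_card_image (cycleRep σ) Finset.univ
    rw [Finset.sum_congr rfl (g := fun _ => r), Finset.sum_const, Finset.card_univ,
      Fintype.card_fin, smul_eq_mul] at h1
    · exact Nat.eq_of_mul_eq_mul_right (by omega) (h1.symm.trans hm.symm)
    · intro a ha
      obtain ⟨i, _, rfl⟩ := Finset.mem_image.1 ha
      exact card_cycleRep_fiber h hm i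
  rw [(blockTriangular_lazyMatrix σ t).det, Finset.prod_congr rfl hblock, Finset.prod_const, hcard]

theorem card_cycleType_replicate {r m : ℕ} (hr : 2 ≤ r) (hm : m * r = N) :
    ((Finset.univ.filter fun σ : Equiv.Perm (Fin N) =>
      σ.cycleType = Multiset.replicate m r).card : ℝ) = (N ! : ℝ) / (r ^ m * m ! : ℝ) := by
  have h := Equiv.Perm.card_of_cycleType_mul_eq (Fin N) (Multiset.replicate m r)
  have hcond : (Multiset.replicate m r).sum ≤ Fintype.card (Fin N) ∧
      ∀ a ∈ Multiset.replicate m r, 2 ≤ a :=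
    ⟨by simp [hm], fun a ha => (Multiset.eq_of_mem_replicate ha).symm ▸ hr⟩
  have hp : ∏ n ∈ (Multiset.replicate m r).toFinset, (Multiset.count n (Multiset.replicate m r))! =
      m ! := by
    rcases Nat.eq_zero_or_pos m with rfl | hm0
    · simp
    · rw [Multiset.toFinset_replicate, if_neg hm0.ne', Finset.prod_singleton,
        Multiset.count_replicate_self]
  rw [if_pos hcond, hp] at h
  simp only [Multiset.sum_replicate, smul_eq_mul, hm, Fintype.card_fin, Nat.sub_self,
    Nat.factorial_zero, one_mul, Multiset.prod_replicate] at h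
  rw [eq_div_iff (by positivity)]
  exact_mod_cast h

/-- The number of pairs of maximal cycles whose product has a given property. -/
theorem card_product_filter (hN : 1 ≤ N) (A : Equiv.Perm (Fin N) → Prop) [DecidablePred A] :
    ((maxCycles N ×ˢ maxCycles N).filter fun p => A (p.1 * p.2)).card =
      ∑ σ ∈ Finset.univ.filter A, factorizationCount σ := by
  classical
  rw [maxCycles_eq hN]
  have h1 : ∀ σ : Equiv.Perm (Fin N), factorizationCount σ =
      (((fullCycles (Fin N) ×ˢ fullCycles (Fin N)).filter fun p => A (p.1 * p.2)).filter
        fun p => p.1 * p.2 = σ).card ∨ ¬ A σ := by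
    intro σ
    by_cases hA : A σ
    · left
      rw [factorizationCount]
      refine Finset.card_nbij' (fun τ => (σ * τ⁻¹, τ)) Prod.snd ?_ ?_ ?_ ?_
      · intro τ hτ
        simp only [Finset.mem_coe, Finset.mem_filter, Finset.mem_product, mem_fullCycles] at hτ ⊢
        simp [hτ.1, hτ.2, hA]
      · rintro ⟨p, q⟩ hpq
        simp only [Finset.mem_coe, Finset.mem_filter, Finset.mem_product, mem_fullCycles] at hpq ⊢
        obtain ⟨⟨⟨hp, hq⟩, -⟩, rfl⟩ := hpq
        simp [hp, hq]
      · intro τ _; rfl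
      · rintro ⟨p, q⟩ hpq
        simp only [Finset.mem_coe, Finset.mem_filter, Finset.mem_product] at hpq
        rw [← hpq.2]
        simp
    · exact Or.inr hA
  rw [Finset.card_eq_sum_card_fiberwise (f := fun p => p.1 * p.2) (t := Finset.univ.filter A)]
  · refine Finset.sum_congr rfl fun σ hσ => ?_
    exact ((h1 σ).resolve_right (not_not.2 (Finset.mem_filter.1 hσ).2)).symm
  · intro p hp
    simp only [Finset.mem_coe, Finset.mem_filter] at hp ⊢
    exact ⟨Finset.mem_univ _, hp.2⟩

theorem equalCyclesProb_of_not_dvd {r : ℕ} (hr : 2 ≤ r) (h : ¬ r ∣ N) :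
    equalCyclesProb N r = 0 := by
  rw [equalCyclesProb, productProb, Finset.filter_false_of_mem]
  · simp
  · exact fun p _ hp => h ((allCyclesHaveLength_iff hr _).1 hp).1

theorem equalCyclesProb_eq_integral (hN : 1 ≤ N) {r : ℕ} (hr : 2 ≤ r) (h : r ∣ N) :
    (equalCyclesProb N r : ℝ) = (N : ℝ) / ((r : ℝ) ^ (N / r) * ((N / r)! : ℝ)) *
      ∫ t in (0 : ℝ)..1, (t ^ r + (-1 : ℝ) ^ (r + 1) * (1 - t) ^ r) ^ (N / r) := by
  have : Nonempty (Fin N) := ⟨⟨0, hN⟩⟩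
  have hm : N / r * r = N := Nat.div_mul_cancel h
  -- Substitution of `1 - t` for `t`.
  have hint : ∫ t in (0 : ℝ)..1, ((1 - t) ^ r - (-t) ^ r) ^ (N / r) =
      ∫ t in (0 : ℝ)..1, (t ^ r + (-1 : ℝ) ^ (r + 1) * (1 - t) ^ r) ^ (N / r) := by
    have h1 := intervalIntegral.integral_comp_sub_left (a := 0) (b := 1)
      (fun t : ℝ => ((1 - t) ^ r - (-t) ^ r) ^ (N / r)) 1
    rw [sub_self, sub_zero] at h1
    rw [← h1]
    refine intervalIntegral.integral_congr fun t _ => ?_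
    rw [neg_pow (1 - t)]
    ring
  have hset : (Finset.univ.filter (AllCyclesHaveLength r : Equiv.Perm (Fin N) → Prop)) =
      Finset.univ.filter fun σ => σ.cycleType = Multiset.replicate (N / r) r :=
    Finset.filter_congr fun σ _ => by rw [allCyclesHaveLength_iff hr, and_iff_right h]
  have hnum : ((((maxCycles N ×ˢ maxCycles N).filter
      fun p => AllCyclesHaveLength r (p.1 * p.2)).card : ℕ) : ℝ) =
      (N ! : ℝ) / (r ^ (N / r) * (N / r)! : ℝ) * (((N - 1)! : ℝ) *
        ∫ t in (0 : ℝ)..1, (t ^ r + (-1 : ℝ) ^ (r + 1) * (1 - t) ^ r) ^ (N / r)) := by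
    rw [card_product_filter hN, hset, ← card_cycleType_replicate hr hm, ← nsmul_eq_mul,
      ← Finset.sum_const, Nat.cast_sum]
    refine Finset.sum_congr rfl fun σ hσ => ?_
    rw [factorizationCount_eq, Fintype.card_fin, ← hint]
    congr 2
    funext t
    exact det_lazyMatrix_of_cycleType hr (Finset.mem_filter.1 hσ).2 hm t
  have hden : (maxCycles N ×ˢ maxCycles N).card = (N - 1)! * (N - 1)! := by
    rw [Finset.card_product, maxCycles_eq hN, card_fullCycles, Fintype.card_fin]
  have hfac : (N ! : ℝ) = N * ((N - 1)! : ℝ) := by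
    rw [← Nat.cast_mul, Nat.mul_factorial_pred (by omega)]
  rw [equalCyclesProb, productProb]
  push_cast
  rw [hnum, hden, hfac]
  have h1 : ((N - 1)! : ℝ) ≠ 0 := by positivity
  have h2 : ((r : ℝ) ^ (N / r)) ≠ 0 := by positivity
  have h3 : ((N / r)! : ℝ) ≠ 0 := by positivity
  push_cast
  field_simp

/-- A product of two maximal cycles is even, while an odd number of cycles of even length is an odd
permutation. -/
theorem equalCyclesProb_of_even (hN : 1 ≤ N) {r : ℕ} (hr : 2 ≤ r) (he : Even r)
    (h : ¬ 2 * r ∣ N) : equalCyclesProb N r = 0 := by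
  by_cases hd : r ∣ N
  · have hodd : Odd (N / r) := by
      rw [← Nat.not_even_iff_odd]
      rintro hev
      refine h ?_
      rw [← Nat.div_mul_cancel hd]
      exact mul_dvd_mul_right hev.two_dvd r
    have : Nonempty (Fin N) := ⟨⟨0, hN⟩⟩
    rw [equalCyclesProb, productProb, Finset.filter_false_of_mem]
    · simp
    · rintro ⟨p, q⟩ hpq hA
      rw [maxCycles_eq hN, Finset.mem_product, mem_fullCycles, mem_fullCycles] at hpq
      have h1 := Equiv.Perm.sign_of_cycleType (p * q)
      rw [((allCyclesHaveLength_iff hr _).1 hA).2, map_mul, hpq.1.sign, hpq.2.sign, ← mul_pow] at h1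
      simp only [Multiset.sum_replicate, Multiset.card_replicate, smul_eq_mul, mul_neg, mul_one,
        neg_neg, one_pow, pow_add, hodd.neg_one_pow, (he.mul_left (N / r)).neg_one_pow] at h1
      exact absurd h1 (by decide)
  · exact equalCyclesProb_of_not_dvd hr hd

/-- Binomial expansion with `j = i * r`; each Beta integral equals `1 / ((N + 1) * N.choose j)`. -/
theorem integral_eq_sum {r : ℕ} (hr : 2 ≤ r) (h : r ∣ N) :
    ∫ t in (0 : ℝ)..1, (t ^ r + (-1 : ℝ) ^ (r + 1) * (1 - t) ^ r) ^ (N / r) =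
      1 / ((N : ℝ) + 1) * ∑ j ∈ (Finset.range (N + 1)).filter (fun j => r ∣ j),
        (-1 : ℝ) ^ ((j / r) * (r + 1)) * (((N / r).choose (j / r) : ℝ) / (N.choose j : ℝ)) := by
  have hr0 : 0 < r := by omega
  have hm : N / r * r = N := Nat.div_mul_cancel h
  have hsum : ∑ j ∈ (Finset.range (N + 1)).filter (fun j => r ∣ j),
        (-1 : ℝ) ^ ((j / r) * (r + 1)) * (((N / r).choose (j / r) : ℝ) / (N.choose j : ℝ)) =
      ∑ i ∈ Finset.range (N / r + 1),
        (-1 : ℝ) ^ (i * (r + 1)) * (((N / r).choose i : ℝ) / (N.choose (i * r) : ℝ)) := by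
    refine Finset.sum_nbij' (fun j => j / r) (fun i => i * r) ?_ ?_ ?_ ?_ ?_
    · intro j hj
      rw [Finset.mem_filter, Finset.mem_range] at hj
      rw [Finset.mem_range, Nat.lt_succ_iff]
      exact Nat.div_le_div_right (by omega)
    · intro i hi
      rw [Finset.mem_range, Nat.lt_succ_iff] at hi
      rw [Finset.mem_filter, Finset.mem_range, Nat.lt_succ_iff]
      exact ⟨hm ▸ Nat.mul_le_mul_right r hi, dvd_mul_left r i⟩
    · intro j hj
      exact Nat.div_mul_cancel (Finset.mem_filter.1 hj).2
    · intro i _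
      exact Nat.mul_div_cancel i hr0
    · intro j hj
      simp only [Nat.div_mul_cancel (Finset.mem_filter.1 hj).2]
  have hexp : ∀ t : ℝ, (t ^ r + (-1 : ℝ) ^ (r + 1) * (1 - t) ^ r) ^ (N / r) =
      ∑ i ∈ Finset.range (N / r + 1), ((-1 : ℝ) ^ (i * (r + 1)) * (N / r).choose i) *
        (t ^ (N - i * r) * (1 - t) ^ (i * r)) := by
    intro t
    rw [add_comm, add_pow]
    refine Finset.sum_congr rfl fun i hi => ?_
    have : N - i * r = r * (N / r - i) := by
      rw [Nat.mul_sub, mul_comm r (N / r), hm, mul_comm r i]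
    rw [this, mul_pow, ← pow_mul, ← pow_mul, ← pow_mul, mul_comm i (r + 1), mul_comm i r]
    ring
  rw [hsum]
  simp only [hexp]
  rw [intervalIntegral.integral_finsetSum
    (fun S _ => Continuous.intervalIntegrable (by fun_prop) _ _), Finset.mul_sum]
  refine Finset.sum_congr rfl fun i hi => ?_
  rw [Finset.mem_range, Nat.lt_succ_iff] at hi
  have hle : i * r ≤ N := hm ▸ Nat.mul_le_mul_right r hi
  rw [intervalIntegral.integral_const_mul, integral_pow_mul_one_sub_pow, Nat.sub_add_cancel hle,
    Nat.factorial_succ, Nat.cast_choose ℝ hle]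
  have h1 : (N ! : ℝ) ≠ 0 := by positivity
  have h2 : ((i * r)! : ℝ) ≠ 0 := by positivity
  have h3 : ((N - i * r)! : ℝ) ≠ 0 := by positivity
  have h4 : (N + 1 : ℝ) ≠ 0 := by positivity
  push_cast
  field_simp

theorem integral_linear_pow {n : ℕ} (hn : Even n) :
    ∫ t in (0 : ℝ)..1, (2 * t - 1) ^ n = 1 / ((n : ℝ) + 1) := by
  rw [intervalIntegral.integral_comp_mul_sub (fun x : ℝ => x ^ n) two_ne_zero, integral_pow]
  have : (n + 1 : ℝ) ≠ 0 := by positivity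
  norm_num [hn.add_one.neg_one_pow]
  field_simp

end EqualCycles

end CycleProduct

theorem mainTheorem10 (N : ℕ) (hN : 1 ≤ N) :
    (∀ r : ℕ, 2 ≤ r →
      (¬ r ∣ N → CycleProduct.equalCyclesProb N r = 0) ∧
      (Even r → ¬ 2 * r ∣ N → CycleProduct.equalCyclesProb N r = 0) ∧
      (r ∣ N →
        (CycleProduct.equalCyclesProb N r : ℝ) =
            (N : ℝ) / ((r : ℝ) ^ (N / r) * ((N / r)! : ℝ)) *
              (∫ t in (0 : ℝ)..1, (t ^ r + (-1 : ℝ) ^ (r + 1) * (1 - t) ^ r) ^ (N / r)) ∧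
        (CycleProduct.equalCyclesProb N r : ℝ) =
            (N : ℝ) / (((N : ℝ) + 1) * (r : ℝ) ^ (N / r) * ((N / r)! : ℝ)) *
              ∑ j ∈ (Finset.range (N + 1)).filter (fun j => r ∣ j),
                (-1 : ℝ) ^ ((j / r) * (r + 1)) *
                  (((N / r).choose (j / r) : ℝ) / (N.choose j : ℝ)))) ∧
    (4 ∣ N →
      (CycleProduct.equalCyclesProb N 2 : ℝ) =
        (N : ℝ) / ((2 : ℝ) ^ (N / 2) * ((N / 2 + 1)! : ℝ))) ∧
    (3 ∣ N →
      (CycleProduct.equalCyclesProb N 3 : ℝ) =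
        (N : ℝ) / (((N / 3)! : ℝ) * (12 : ℝ) ^ (N / 3)) *
          ∑ j ∈ Finset.range (N / 3 + 1),
            ((N / 3).choose j : ℝ) * ((3 : ℝ) ^ j / (2 * (j : ℝ) + 1))) := by
  refine ⟨fun r hr => ⟨CycleProduct.equalCyclesProb_of_not_dvd hr,
    CycleProduct.equalCyclesProb_of_even hN hr, fun h =>
      ⟨CycleProduct.equalCyclesProb_eq_integral hN hr h, ?_⟩⟩, fun h => ?_, fun h => ?_⟩
  · rw [CycleProduct.equalCyclesProb_eq_integral hN hr h, CycleProduct.integral_eq_sum hr h,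
      ← mul_assoc]
    congr 1
    rw [div_mul_div_comm, mul_one]
    congr 1
    ring
  · have h2 : 2 ∣ N := dvd_trans (by norm_num) h
    have he : Even (N / 2) := by
      obtain ⟨k, rfl⟩ := h
      exact ⟨k, by omega⟩
    rw [CycleProduct.equalCyclesProb_eq_integral hN le_rfl h2]
    -- For `r = 2` the base is linear, and `4 ∣ N` makes its exponent even.
    have hf : ∀ t : ℝ, t ^ 2 + (-1 : ℝ) ^ (2 + 1) * (1 - t) ^ 2 = 2 * t - 1 := fun t => by ring
    simp only [hf]
    rw [CycleProduct.integral_linear_pow he, Nat.factorial_succ]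
    push_cast
    rw [div_mul_div_comm, mul_one]
    congr 1
    ring
  · rw [CycleProduct.equalCyclesProb_eq_integral hN (by norm_num) h]
    -- The base is symmetric about `1/2`, hence a polynomial in `(2 * t - 1) ^ 2`; the factor `1/4`
    -- turns `3 ^ (N / 3)` into `12 ^ (N / 3)`.
    have hf : ∀ t : ℝ, (t ^ 3 + (-1 : ℝ) ^ (3 + 1) * (1 - t) ^ 3) ^ (N / 3) =
        (1 / 4) ^ (N / 3) * ∑ j ∈ Finset.range (N / 3 + 1),
          ((N / 3).choose j * 3 ^ j : ℝ) * (2 * t - 1) ^ (2 * j) := fun t => by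
      have h1 : t ^ 3 + (-1 : ℝ) ^ (3 + 1) * (1 - t) ^ 3 =
          1 / 4 * (3 * (2 * t - 1) ^ 2 + 1) := by ring
      rw [h1, mul_pow, add_pow]
      congr 1
      refine Finset.sum_congr rfl fun j _ => ?_
      rw [mul_pow, one_pow, ← pow_mul]
      ring
    simp only [hf]
    rw [intervalIntegral.integral_const_mul, intervalIntegral.integral_finsetSum
      (fun S _ => Continuous.intervalIntegrable (by fun_prop) _ _), ← mul_assoc]
    congr 1
    · have h12 : (12 : ℝ) ^ (N / 3) = 3 ^ (N / 3) * 4 ^ (N / 3) := by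
        rw [← mul_pow]; norm_num
      rw [h12, one_div, inv_pow]
      have h3 : ((3 : ℝ) ^ (N / 3)) ≠ 0 := by positivity
      have h4 : ((4 : ℝ) ^ (N / 3)) ≠ 0 := by positivity
      have h5 : ((N / 3)! : ℝ) ≠ 0 := by positivity
      push_cast
      field_simp
    · refine Finset.sum_congr rfl fun j _ => ?_
      rw [intervalIntegral.integral_const_mul,
        CycleProduct.integral_linear_pow (even_two_mul j)]
      push_cast
      ring
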